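/- Let $P,Q\in\mathbb{C}[x,y]$ and consider the planar polynomial vector field $\mathcal{X}=P\,\partial_x+Q\,\partial_y$. Let $F\in\mathbb{C}[x,y]\setminus\mathbb{C}$ be an irreducible invariant algebraic curve of $\mathcal{X}$ with cofactor $\lambda\in\mathbb{C}[x,y]$, that is, $P F_x+Q F_y=\lambda F$. A Puiseux series at infinity is a formal series $\sum_{l\ge 0}c_l x^{(l_0-l)/n_0}$ with $c_l\in\mathbb{C}$, $l_0\in\mathbb{Z}$, $n_0\in\mathbb{N}$; its derivative $y_x$ is taken term by term. For a formal sum $W$ of monomials $c\,x^{q_1}y^{q_2}$ let $\{W\}_+$ be its polynomial part, the sum of those monomials of $W$ for which $q_1,q_2$ are non-negative integers. Suppose that $$F(x,y)=\Big\{\mu(x)\prod_{j=1}^{N}\big(y-y_j(x)\big)\Big\}_+ ,$$ where $N\ge 0$, $\mu\in\mathbb{C}[x]$ and $y_1,\dots,y_N$ are pairwise distinct Puiseux series at infinity that are captured by the curve, that is, $F(x,y_j(x))=0$ for every $j$. Let $x_1,\dots,x_L$ be the pairwise distinct zeros of $\mu$ and $\nu_1,\dots,\nu_L$ their multiplicities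 ($L=0$ if $\mu$ is constant). Then $$\lambda(x,y)=\Big\{P(x,y)\sum_{m=0}^{\infty}\sum_{l=1}^{L}\frac{\nu_l x_l^m}{x^{m+1}}+\sum_{m=0}^{\infty}\sum_{j=1}^{N}\frac{\big(Q(x,y)-P(x,y)\,y_{j,x}(x)\big)\,y_j(x)^m}{y^{m+1}}\Big\}_+ ,$$ where $0^0=1$ and the expression in braces is a formal Laurent series in $y^{-1}$ whose coefficients are Puiseux series at infinity. -/

import Mathlib

open Polynomial

noncomputable section

namespace PuiseuxCurve

/-! ### Polynomials in two variables and polynomial vector fields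

`ℂ[x, y]` is `ℂ[X][X]`: polynomials in `y` whose coefficients are polynomials in `x`. -/

/-- The partial derivative `F_x`: differentiate every coefficient of `F` as a polynomial in `x`. -/
def partialX (F : ℂ[X][X]) : ℂ[X][X] :=
  ∑ n ∈ F.support, monomial n (derivative (F.coeff n))

/-- The partial derivative `F_y`. -/
def partialY (F : ℂ[X][X]) : ℂ[X][X] := derivative F

/-- `F` is an invariant algebraic curve (a Darboux polynomial) of the vector field
`P ∂/∂x + Q ∂/∂y`, with cofactor `lam`: `F` is not a constant and `P F_x + Q F_y = lam F`. -/
def IsInvariantCurveWithCofactor (P Q F lam : ℂ[X][X]) : Prop :=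
  (∀ c : ℂ, F ≠ C (C c)) ∧ P * partialX F + Q * partialY F = lam * F

/-! ### Puiseux series at infinity

A Hahn series `w : HahnSeries ℚ ℂ` is read as a formal series in `x⁻¹` with rational exponents:
`w.coeff q` is the coefficient of `x ^ (-q)`. -/

/-- The field of formal series in `x⁻¹` with rational exponents and well-ordered support.
It contains the field of Puiseux series at infinity. -/
abbrev XSeries : Type := HahnSeries ℚ ℂ

/-- `w` is a Puiseux series at infinity: its exponents have a common denominator. (They are
bounded above because the support of `w` is well-ordered.) -/
def IsPuiseuxAtInfinity (w : XSeries) : Prop :=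
  ∃ n : ℕ, 0 < n ∧ ∀ q : ℚ, w.coeff q ≠ 0 → ∃ k : ℤ, q = (k : ℚ) / (n : ℚ)

/-- The term-by-term derivative with respect to `x`, which takes `c x ^ (-q)` to
`(-q) c x ^ (-(q + 1))`. -/
def ddx (w : XSeries) : XSeries where
  coeff q := -((q - 1 : ℚ) : ℂ) * w.coeff (q - 1)
  isPWO_support' := by
    have h : (Function.support fun q : ℚ => -((q - 1 : ℚ) : ℂ) * w.coeff (q - 1)) ⊆
        (fun q : ℚ => q + 1) '' w.support := by
      intro q hq
      refine ⟨q - 1, ?_, by ring⟩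
      exact right_ne_zero_of_mul hq
    refine Set.IsPWO.mono ?_ h
    exact w.isPWO_support.image_of_monotone (fun a b hab => by simpa using hab)

/-- A polynomial in `x` as a series in `x⁻¹`. -/
def ofPolyX : ℂ[X] →+* XSeries :=
  eval₂RingHom HahnSeries.C (HahnSeries.single (-1 : ℚ) (1 : ℂ))

/-- Substitution of a series `w` for `y` in `F`, that is `F(x, w(x))`. -/
def substY (F : ℂ[X][X]) (w : XSeries) : XSeries := eval₂ ofPolyX w F

/-! ### Formal series in `y⁻¹` over the series in `x⁻¹`

For `W : XYSeries`, `(W.coeff k).coeff q` is the coefficient of the monomial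
`x ^ (-q) * y ^ (-k)`. -/

/-- Laurent series in `y⁻¹` with coefficients in a field `K`. -/
abbrev YSeries (K : Type) [Field K] : Type := HahnSeries ℤ K

/-- Laurent series in `y⁻¹` with coefficients in `XSeries`. -/
abbrev XYSeries : Type := YSeries XSeries

/-- The variable `y`. -/
def varY : XYSeries := HahnSeries.single (-1 : ℤ) (1 : XSeries)

/-- A series in `x⁻¹` as an element of `XYSeries` that does not involve `y`. -/
def ofX : XSeries →+* XYSeries := HahnSeries.C

/-- A polynomial in `x` and `y` as an element of `XYSeries`. -/
def ofPolyXY : ℂ[X][X] →+* XYSeries := eval₂RingHom (ofX.comp ofPolyX) varY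

/-- The series `∑_{m ≥ 0} c m / x ^ (m + 1)`. -/
def sumInvPowX (c : ℕ → ℂ) : XSeries :=
  HahnSeries.single (1 : ℚ) (1 : ℂ) * HahnSeries.ofPowerSeries ℚ ℂ (PowerSeries.mk c)

/-- The series `∑_{m ≥ 0} c m / y ^ (m + 1)`. -/
def sumInvPowY (c : ℕ → XSeries) : XYSeries :=
  HahnSeries.single (1 : ℤ) (1 : XSeries) * HahnSeries.ofPowerSeries ℤ XSeries (PowerSeries.mk c)

/-! ### The polynomial part -/

/-- The sum of the monomials of `w` whose exponents are non-negative integers. -/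
def polyPartX (w : XSeries) : ℂ[X] :=
  ∑ n ∈ Finset.range (⌊-w.order⌋₊ + 1), monomial n (w.coeff (-(n : ℚ)))

theorem coeff_polyPartX (w : XSeries) (n : ℕ) :
    (polyPartX w).coeff n = w.coeff (-(n : ℚ)) := by
  simp only [polyPartX, finsetSum_coeff, coeff_monomial, Finset.sum_ite_eq', Finset.mem_range]
  split_ifs with h
  · rfl
  · by_contra hne
    have h1 := HahnSeries.order_le_of_coeff_ne_zero (Ne.symm hne)
    exact h (Nat.lt_succ_of_le (Nat.le_floor (by linarith)))

/-- The projection `{W}_+`: the sum of the monomials of `W` in which the exponents of `x` and of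
`y` are non-negative integers. -/
def polyPart (W : XYSeries) : ℂ[X][X] :=
  ∑ k ∈ Finset.range ((-W.order).toNat + 1), monomial k (polyPartX (W.coeff (-(k : ℤ))))

theorem coeff_polyPart (W : XYSeries) (k n : ℕ) :
    ((polyPart W).coeff k).coeff n = (W.coeff (-(k : ℤ))).coeff (-(n : ℚ)) := by
  rw [← coeff_polyPartX]
  congr 1
  simp only [polyPart, finsetSum_coeff, coeff_monomial, Finset.sum_ite_eq', Finset.mem_range]
  split_ifs with h
  · rfl
  · have h0 : W.coeff (-(k : ℤ)) = 0 := by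
      by_contra hne
      have h1 := HahnSeries.order_le_of_coeff_ne_zero hne
      omega
    ext m
    rw [h0, coeff_polyPartX]
    simp

/-! ### The representation of a curve by Puiseux series at infinity -/

/-- `F = {μ(x) ∏_j (y - y_j(x))}_+`, where `y_1, …, y_N` are pairwise distinct Puiseux series at
infinity that are captured by the curve, that is `F(x, y_j(x)) = 0`. -/
structure IsPuiseuxRepresentation (F : ℂ[X][X]) (μ : ℂ[X]) {N : ℕ} (y : Fin N → XSeries) :
    Prop where
  puiseux : ∀ j, IsPuiseuxAtInfinity (y j)
  distinct : Function.Injective y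
  captured : ∀ j, substY F (y j) = 0
  eq_polyPart : F = polyPart (ofX (ofPolyX μ) * ∏ j, (varY - ofX (y j)))

end PuiseuxCurve

end

open PuiseuxCurve

namespace PuiseuxCurve

/-! ### The derivation `d/dx` on series in `x⁻¹` -/

/-! Taking the polynomial part of `μ ∏ (y - y_j)` loses nothing: `F` equals that product over
`XSeries` (`map_eq_prod`). Both have `μ` as coefficient of `y ^ N` and nothing above it, so their
difference has degree below `N` in `y` and vanishes at the `N` distinct series `y_j`. With `D = P ∂x
+ Q ∂y`, the cofactor is `D F / F`. Logarithmic derivatives turn products into sums, which gives `P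
μ'/μ + ∑ (Q - P y_j') / (y - y_j)` (`ofPolyXY_cofactor`). The series in the statement are the
geometric expansions of these fractions in `x⁻¹` and `y⁻¹`, so the braces contain exactly `lam`,
which `polyPart` fixes. -/

theorem ddx_coeff (w : XSeries) (q : ℚ) :
    (ddx w).coeff q = -((q - 1 : ℚ) : ℂ) * w.coeff (q - 1) := rfl

/-- The term-by-term operator `x d/dx`. -/
def eulerX (w : XSeries) : XSeries where
  coeff q := -(q : ℂ) * w.coeff q
  isPWO_support' := w.isPWO_support.mono fun _ hq => right_ne_zero_of_mul hq

theorem eulerX_coeff (w : XSeries) (q : ℚ) : (eulerX w).coeff q = -(q : ℂ) * w.coeff q := rfl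

theorem support_eulerX_subset (w : XSeries) : (eulerX w).support ⊆ w.support :=
  fun _ hq => right_ne_zero_of_mul hq

/-- Each monomial is an eigenvector of `x d/dx`, with its exponent as eigenvalue, and exponents add
under multiplication. As exponents are not shifted, all three coefficient sums can run over one
antidiagonal; `ddx` inherits the rule through the factor `x⁻¹`. -/
theorem eulerX_mul (v w : XSeries) : eulerX (v * w) = v * eulerX w + w * eulerX v := by
  ext q
  rw [mul_comm w, HahnSeries.coeff_add, eulerX_coeff, HahnSeries.coeff_mul,
    HahnSeries.coeff_mul_right' w.isPWO_support (support_eulerX_subset w),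
    HahnSeries.coeff_mul_left' v.isPWO_support (support_eulerX_subset v),
    Finset.mul_sum, ← Finset.sum_add_distrib]
  refine Finset.sum_congr rfl fun ij hij => ?_
  obtain ⟨-, -, h⟩ := Finset.mem_antidiagonal.1 hij
  rw [eulerX_coeff, eulerX_coeff, ← h]
  push_cast
  ring

theorem ddx_eq_single_mul_eulerX (w : XSeries) :
    ddx w = HahnSeries.single (1 : ℚ) (1 : ℂ) * eulerX w := by
  ext q
  rw [HahnSeries.coeff_single_mul, one_mul, ddx_coeff, eulerX_coeff]

theorem ddx_mul (v w : XSeries) : ddx (v * w) = v * ddx w + w * ddx v := by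
  simp only [ddx_eq_single_mul_eulerX, eulerX_mul]
  ring

theorem ddx_zero : ddx 0 = 0 := by
  ext q
  simp [ddx_coeff]

theorem ddx_add (v w : XSeries) : ddx (v + w) = ddx v + ddx w := by
  ext q
  simp only [ddx_coeff, HahnSeries.coeff_add]
  ring

theorem ddx_sub (v w : XSeries) : ddx (v - w) = ddx v - ddx w := by
  ext q
  simp only [ddx_coeff, HahnSeries.coeff_sub]
  ring

theorem ddx_one : ddx 1 = 0 := by
  simpa using ddx_mul 1 1

theorem ddx_sum {ι : Type*} (s : Finset ι) (f : ι → XSeries) :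
    ddx (∑ i ∈ s, f i) = ∑ i ∈ s, ddx (f i) :=
  map_sum (AddMonoidHom.mk' ddx ddx_add) f s

/-- Coefficientwise differentiation with respect to `x` of polynomials in `y`. -/
noncomputable def ddxCoeffs (G : XSeries[X]) : XSeries[X] :=
  ∑ n ∈ G.support, monomial n (ddx (G.coeff n))

theorem coeff_ddxCoeffs (G : XSeries[X]) (n : ℕ) :
    (ddxCoeffs G).coeff n = ddx (G.coeff n) := by
  simp only [ddxCoeffs, finsetSum_coeff, coeff_monomial, Finset.sum_ite_eq']
  split_ifs with h
  · rfl
  · rw [notMem_support_iff.1 h, ddx_zero]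

theorem ddxCoeffs_mul (G H : XSeries[X]) :
    ddxCoeffs (G * H) = G * ddxCoeffs H + H * ddxCoeffs G := by
  ext1 n
  rw [mul_comm H, coeff_add, coeff_ddxCoeffs, coeff_mul, coeff_mul, coeff_mul, ddx_sum,
    ← Finset.sum_add_distrib]
  refine Finset.sum_congr rfl fun ij _ => ?_
  rw [coeff_ddxCoeffs, coeff_ddxCoeffs, ddx_mul, mul_comm (H.coeff _)]

theorem ddxCoeffs_C (w : XSeries) : ddxCoeffs (C w) = C (ddx w) := by
  ext1 n
  rw [coeff_ddxCoeffs, coeff_C, coeff_C]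
  split_ifs <;> simp [ddx_zero]

theorem ddxCoeffs_X_sub_C (w : XSeries) : ddxCoeffs (X - C w) = -C (ddx w) := by
  ext1 n
  rw [coeff_ddxCoeffs, coeff_sub, coeff_neg, ddx_sub, ← coeff_ddxCoeffs (C w), ddxCoeffs_C, coeff_X]
  split_ifs <;> simp [ddx_zero, ddx_one]

/-! ### Embeddings -/

theorem ofPolyX_monomial (n : ℕ) (c : ℂ) :
    ofPolyX (monomial n c) = HahnSeries.single (-(n : ℚ)) c := by
  simp [ofPolyX, eval₂_monomial, HahnSeries.single_pow, HahnSeries.C_apply,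
    HahnSeries.single_mul_single]

theorem coeff_ofPolyX (p : ℂ[X]) (n : ℕ) : (ofPolyX p).coeff (-(n : ℚ)) = p.coeff n := by
  induction p using Polynomial.induction_on' with
  | add p q hp hq => simp [hp, hq]
  | monomial m c =>
    rw [ofPolyX_monomial, HahnSeries.coeff_single, coeff_monomial]
    simp [eq_comm]

theorem ofPolyX_injective : Function.Injective ofPolyX := fun p q h => by
  ext n
  rw [← coeff_ofPolyX, h, coeff_ofPolyX]

theorem polyPartX_ofPolyX (p : ℂ[X]) : polyPartX (ofPolyX p) = p := by
  ext n
  rw [coeff_polyPartX, coeff_ofPolyX]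

theorem ddx_ofPolyX (p : ℂ[X]) : ddx (ofPolyX p) = ofPolyX (derivative p) := by
  induction p using Polynomial.induction_on' with
  | add p q hp hq =>
    rw [map_add, map_add, map_add, ← hp, ← hq, ddx_add]
  | monomial m c =>
    rw [derivative_monomial, ofPolyX_monomial, ofPolyX_monomial]
    ext q
    rw [ddx_coeff, HahnSeries.coeff_single, HahnSeries.coeff_single]
    -- Constants are separate because `m - 1` is truncated at `m = 0`; there the factor `q - 1`
    -- kills the only term.
    rcases m with _ | m
    · by_cases hq : q = 1 <;> simp [hq, sub_eq_zero]
    · have e : q - 1 = -((m + 1 : ℕ) : ℚ) ↔ q = -((m + 1 - 1 : ℕ) : ℚ) := by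
        push_cast [Nat.add_sub_cancel]
        constructor <;> intro h <;> linarith
      by_cases hq : q - 1 = -((m + 1 : ℕ) : ℚ)
      · rw [if_pos hq, if_pos (e.1 hq), hq]
        push_cast
        ring
      · rw [if_neg hq, if_neg (e.not.1 hq), mul_zero]

theorem map_partialX (F : ℂ[X][X]) : (partialX F).map ofPolyX = ddxCoeffs (F.map ofPolyX) := by
  ext1 n
  rw [coeff_ddxCoeffs, coeff_map, coeff_map, ddx_ofPolyX]
  congr 1
  simp only [partialX, finsetSum_coeff, coeff_monomial, Finset.sum_ite_eq', mem_support_iff]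
  split_ifs with h
  · rfl
  · rw [not_not.1 h, derivative_zero]

/-- Polynomials in `y` over the series in `x⁻¹`, as Laurent series in `y⁻¹`. -/
noncomputable def ofPolyY : XSeries[X] →+* XYSeries := eval₂RingHom ofX varY

theorem ofPolyY_C (w : XSeries) : ofPolyY (C w) = ofX w := by simp [ofPolyY]

theorem ofPolyY_X : ofPolyY X = varY := by simp [ofPolyY]

theorem coeff_ofPolyY (G : XSeries[X]) (k : ℕ) : (ofPolyY G).coeff (-(k : ℤ)) = G.coeff k := by
  induction G using Polynomial.induction_on' with
  | add p q hp hq => simp [hp, hq]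
  | monomial m c =>
    have h : ofPolyY (monomial m c) = HahnSeries.single (-(m : ℤ)) c := by
      simp [ofPolyY, eval₂_monomial, ofX, varY, HahnSeries.single_pow, HahnSeries.C_apply,
        HahnSeries.single_mul_single]
    rw [h, HahnSeries.coeff_single, coeff_monomial]
    simp [eq_comm]

theorem ofPolyY_injective : Function.Injective ofPolyY := fun p q h => by
  ext1 n
  rw [← coeff_ofPolyY, h, coeff_ofPolyY]

theorem ofPolyY_map (F : ℂ[X][X]) : ofPolyY (F.map ofPolyX) = ofPolyXY F := by
  simp [ofPolyY, ofPolyXY, eval₂_map]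

theorem coeff_polyPart_ofPolyY (G : XSeries[X]) (k : ℕ) :
    (polyPart (ofPolyY G)).coeff k = polyPartX (G.coeff k) := by
  ext n
  rw [coeff_polyPart, coeff_ofPolyY, coeff_polyPartX]

theorem polyPart_ofPolyXY (F : ℂ[X][X]) : polyPart (ofPolyXY F) = F := by
  ext1 k
  rw [← ofPolyY_map, coeff_polyPart_ofPolyY, coeff_map, polyPartX_ofPolyX]

/-! ### Geometric series -/

/-- `single 1 1` is the inverse of the variable, so this expands `1 / (variable - w)` at infinity.
General `Γ` and `K` let it serve for both `x` and `y`. -/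
theorem geom_series_mul {Γ K : Type} [CommRing Γ] [LinearOrder Γ] [IsStrictOrderedRing Γ] [Field K]
    (w : K) :
    HahnSeries.single (1 : Γ) (1 : K) *
        HahnSeries.ofPowerSeries Γ K (PowerSeries.mk fun m => w ^ m) *
      (HahnSeries.single (-1 : Γ) (1 : K) - HahnSeries.C w) = 1 := by
  have h1 : HahnSeries.single (1 : Γ) (1 : K) * HahnSeries.single (-1 : Γ) (1 : K) = 1 := by
    simp [HahnSeries.single_mul_single]
  have h2 : PowerSeries.mk (fun m => w ^ m) * (1 - PowerSeries.X * PowerSeries.C w) = 1 := by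
    ext n
    rw [mul_sub, mul_one, ← mul_assoc, map_sub, PowerSeries.coeff_mul_C]
    rcases n with _ | n
    · simp
    · simp [PowerSeries.coeff_succ_mul_X, PowerSeries.coeff_one, pow_succ]
  have h3 := congrArg (HahnSeries.ofPowerSeries Γ K) h2
  rw [map_mul, map_sub, map_mul, map_one, HahnSeries.ofPowerSeries_X,
    HahnSeries.ofPowerSeries_C] at h3
  linear_combination h3 + HahnSeries.ofPowerSeries Γ K (PowerSeries.mk fun m => w ^ m) * h1

theorem sumInvPowY_eq_inv (w : XSeries) :
    sumInvPowY (fun m => w ^ m) = (varY - ofX w)⁻¹ :=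
  eq_inv_of_mul_eq_one_left (geom_series_mul w)

theorem sumInvPowX_eq_inv (a : ℂ) :
    sumInvPowX (fun m => a ^ m) = (ofPolyX (X - C a))⁻¹ := by
  have h : ofPolyX (X - C a) = HahnSeries.single (-1 : ℚ) (1 : ℂ) - HahnSeries.C a := by
    simp [ofPolyX]
  rw [h]
  exact eq_inv_of_mul_eq_one_left (geom_series_mul a)

theorem sumInvPowX_sum (s : Finset ℂ) (ν : ℂ → ℕ) :
    sumInvPowX (fun m => ∑ a ∈ s, (ν a : ℂ) * a ^ m) =
      ∑ a ∈ s, (ν a : XSeries) * sumInvPowX (fun m => a ^ m) := by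
  have h : PowerSeries.mk (fun m => ∑ a ∈ s, (ν a : ℂ) * a ^ m) =
      ∑ a ∈ s, (ν a : PowerSeries ℂ) * PowerSeries.mk (fun m => a ^ m) := by
    ext n
    simp only [map_sum, PowerSeries.coeff_mk, ← nsmul_eq_mul, map_nsmul]
  simp only [sumInvPowX, h, map_sum, map_mul, map_natCast, Finset.mul_sum]
  exact Finset.sum_congr rfl fun a _ => mul_left_comm _ _ _

/-! ### Logarithmic derivatives -/

section LogDeriv

variable {A L : Type*} [CommRing A] [Field L] (e : A →+* L) {D : A → A}

/-- Quotients are taken in `L` while `D` acts only on `A`, so `D` never has to be extended to the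
series field. Only the Leibniz rule is needed. -/
theorem map_derivation_mul_div
    (hD : ∀ f g, D (f * g) = f * D g + g * D f)
    {f g : A} (hf : e f ≠ 0) (hg : e g ≠ 0) :
    e (D (f * g)) / e (f * g) = e (D f) / e f + e (D g) / e g := by
  rw [hD, map_add, map_mul, map_mul, map_mul]
  field_simp
  ring

theorem map_derivation_prod_div
    (hD : ∀ f g, D (f * g) = f * D g + g * D f)
    {ι : Type*} (s : Finset ι) (f : ι → A)
    (hf : ∀ i ∈ s, e (f i) ≠ 0) :
    e (D (∏ i ∈ s, f i)) / e (∏ i ∈ s, f i) = ∑ i ∈ s, e (D (f i)) / e (f i) := by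
  classical
  induction s using Finset.induction_on with
  | empty =>
    have h1 : D 1 = 0 := by simpa using hD 1 1
    simp [h1]
  | insert i s hi ih =>
    rw [Finset.forall_mem_insert] at hf
    rw [Finset.prod_insert hi, Finset.sum_insert hi, ← ih hf.2,
      map_derivation_mul_div e hD hf.1 (by rw [map_prod]; exact Finset.prod_ne_zero_iff.2 hf.2)]

theorem map_derivation_pow_div
    (hD : ∀ f g, D (f * g) = f * D g + g * D f)
    {f : A} (hf : e f ≠ 0) (n : ℕ) :
    e (D (f ^ n)) / e (f ^ n) = n * (e (D f) / e f) := by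
  simpa using map_derivation_prod_div e hD (Finset.range n) (fun _ => f) fun _ _ => hf

theorem map_derivation_C_mul_prod_X_sub_C_div {K L ι : Type*} [Field K] [Field L] [Fintype ι]
    (e : K[X] →+* L) (he : Function.Injective e) {D : K[X] → K[X]}
    (hD : ∀ f g, D (f * g) = f * D g + g * D f) {c : K} (hc : c ≠ 0) (y : ι → K) :
    e (D (C c * ∏ j, (X - C (y j)))) / e (C c * ∏ j, (X - C (y j))) =
      e (D (C c)) / e (C c) + ∑ j, e (D (X - C (y j))) / e (X - C (y j)) := by
  have hne : ∀ G : K[X], G ≠ 0 → e G ≠ 0 := fun G hG => (map_ne_zero_iff e he).2 hG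
  have hX : ∀ j, X - C (y j) ≠ 0 := fun j => X_sub_C_ne_zero (y j)
  rw [map_derivation_mul_div e hD (hne _ (C_ne_zero.2 hc))
    (hne _ (Finset.prod_ne_zero_iff.2 fun j _ => hX j)),
    map_derivation_prod_div e hD _ _ fun j _ => hne _ (hX j)]

end LogDeriv

/-- The logarithmic derivative of a polynomial, expanded at infinity. -/
theorem sumInvPowX_roots {μ : ℂ[X]} (hμ : μ ≠ 0) :
    sumInvPowX (fun m => ∑ a ∈ μ.roots.toFinset, (μ.rootMultiplicity a : ℂ) * a ^ m) =
      ofPolyX (derivative μ) / ofPolyX μ := by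
  have hX : ∀ p : ℂ[X], p ≠ 0 → ofPolyX p ≠ 0 := fun p hp =>
    (map_ne_zero_iff _ ofPolyX_injective).2 hp
  have hprod : μ = C μ.leadingCoeff *
      ∏ a ∈ μ.roots.toFinset, (X - C a) ^ μ.rootMultiplicity a := by
    rw [← prod_multiset_root_eq_finset_root]
    exact (IsAlgClosed.splits μ).eq_prod_roots
  have hD : ∀ p q : ℂ[X], derivative (p * q) = p * derivative q + q * derivative p :=
    fun p q => by rw [derivative_mul]; ring
  have hXC : ∀ a : ℂ, (X - C a) ≠ 0 := X_sub_C_ne_zero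
  rw [sumInvPowX_sum]
  conv_rhs => rw [hprod]
  rw [map_derivation_mul_div ofPolyX hD (hX _ (by simpa using hμ))
    (hX _ (Finset.prod_ne_zero_iff.2 fun a _ => pow_ne_zero _ (hXC a))),
    map_derivation_prod_div ofPolyX hD _ _ fun a _ => hX _ (pow_ne_zero _ (hXC a))]
  -- The leading coefficient is constant and contributes nothing.
  rw [derivative_C, map_zero, zero_div, zero_add]
  refine Finset.sum_congr rfl fun a _ => ?_
  rw [map_derivation_pow_div ofPolyX hD (hX _ (hXC a)), derivative_X_sub_C, map_one, one_div,
    sumInvPowX_eq_inv]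

/-! ### Factorization of the curve -/

/-- A curve with a Puiseux representation is equal to the product, before taking the
polynomial part. -/
theorem IsPuiseuxRepresentation.map_eq_prod {F : ℂ[X][X]} {μ : ℂ[X]} {N : ℕ}
    {y : Fin N → XSeries} (hy : IsPuiseuxRepresentation F μ y) :
    F.map ofPolyX = C (ofPolyX μ) * ∏ j, (X - C (y j)) := by
  have hmonic : (∏ j, (X - C (y j))).Monic := monic_prod_X_sub_C y Finset.univ
  have hdeg : (∏ j, (X - C (y j))).natDegree = N := by simp
  have hF : F = polyPart (ofPolyY (C (ofPolyX μ) * ∏ j, (X - C (y j)))) := by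
    simpa only [map_mul, map_prod, map_sub ofPolyY, ofPolyY_C, ofPolyY_X] using hy.eq_polyPart
  rw [← sub_eq_zero]
  refine Polynomial.eq_zero_of_degree_lt_of_eval_index_eq_zero Finset.univ
    hy.distinct.injOn ?_ ?_
  · rw [Finset.card_univ, Fintype.card_fin, degree_lt_iff_coeff_zero]
    intro k hk
    have hcoeff : F.coeff k = polyPartX (ofPolyX μ * (∏ j, (X - C (y j))).coeff k) := by
      rw [← coeff_C_mul, ← coeff_polyPart_ofPolyY, ← hF]
    rw [coeff_sub, coeff_map, hcoeff, coeff_C_mul]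
    -- At `k = N` the product is monic, so the coefficient is `μ`, already a polynomial; for `k > N`
    -- it is zero.
    rcases hk.eq_or_lt with rfl | hk
    · have h1 : (∏ j, (X - C (y j))).coeff N = 1 := by
        simpa only [hdeg] using hmonic.coeff_natDegree
      rw [h1, mul_one, polyPartX_ofPolyX, sub_self]
    · rw [coeff_eq_zero_of_natDegree_lt (hdeg.trans_lt hk), mul_zero, sub_zero,
        ← map_zero ofPolyX, polyPartX_ofPolyX]
  · intro j _
    have h := hy.captured j
    rw [substY] at h
    rw [eval_sub, eval_map, h, eval_mul, eval_prod,
      Finset.prod_eq_zero (Finset.mem_univ j) (by simp), mul_zero, sub_zero]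

/-- The cofactor, as a Laurent series in `y⁻¹`, is the logarithmic derivative of the curve along
the vector field. -/
theorem IsPuiseuxRepresentation.ofPolyXY_cofactor {P Q F lam : ℂ[X][X]} (hF0 : F ≠ 0)
    (hF : P * partialX F + Q * partialY F = lam * F)
    {μ : ℂ[X]} {N : ℕ} {y : Fin N → XSeries} (hy : IsPuiseuxRepresentation F μ y) :
    ofPolyXY lam =
      ofPolyXY P * ofX (ofPolyX (derivative μ) / ofPolyX μ) +
        ∑ j, (ofPolyXY Q - ofPolyXY P * ofX (ddx (y j))) / (varY - ofX (y j)) := by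
  have hprod := hy.map_eq_prod
  have hFm : F.map ofPolyX ≠ 0 := (Polynomial.map_ne_zero_iff ofPolyX_injective).2 hF0
  have hμ : ofPolyX μ ≠ 0 := fun h => hFm (by rw [hprod, h, C_0, zero_mul])
  -- The vector field is extended to `XSeries[X]`, where `F` has the factorization above.
  let D : XSeries[X] → XSeries[X] := fun G =>
    P.map ofPolyX * ddxCoeffs G + Q.map ofPolyX * derivative G
  have hD : ∀ G H, D (G * H) = G * D H + H * D G := fun G H => by
    simp only [D, ddxCoeffs_mul, derivative_mul]
    ring
  have hlam : lam.map ofPolyX * F.map ofPolyX = D (F.map ofPolyX) := by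
    simp only [D]
    rw [← map_partialX, derivative_map, ← Polynomial.map_mul, ← Polynomial.map_mul,
      ← Polynomial.map_mul, ← Polynomial.map_add, ← hF, partialY]
  have hlam' : ofPolyXY lam = ofPolyY (D (F.map ofPolyX)) / ofPolyY (F.map ofPolyX) := by
    rw [eq_div_iff ((map_ne_zero_iff _ ofPolyY_injective).2 hFm), ← hlam, map_mul, ofPolyY_map lam]
  rw [hlam', hprod, map_derivation_C_mul_prod_X_sub_C_div ofPolyY ofPolyY_injective hD hμ y]
  congr 1
  · simp only [D]
    rw [ddxCoeffs_C, derivative_C, mul_zero, add_zero, map_mul, ofPolyY_map, ofPolyY_C,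
      ofPolyY_C, ddx_ofPolyX, map_div₀, mul_div_assoc]
  · refine Finset.sum_congr rfl fun j _ => ?_
    simp only [D]
    rw [derivative_X_sub_C, ddxCoeffs_X_sub_C, map_add, map_mul, map_mul, map_sub, map_neg,
      map_one, ofPolyY_map, ofPolyY_map,
      ofPolyY_C, ofPolyY_C, ofPolyY_X]
    congr 1
    ring

end PuiseuxCurve

theorem theorem2 (P Q F lam : ℂ[X][X]) (hirr : Irreducible F)
    (hF : IsInvariantCurveWithCofactor P Q F lam)
    (μ : ℂ[X]) (N : ℕ) (y : Fin N → XSeries) (hy : IsPuiseuxRepresentation F μ y) :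
    lam = polyPart
      (ofPolyXY P *
          ofX (sumInvPowX fun m => ∑ a ∈ μ.roots.toFinset, (μ.rootMultiplicity a : ℂ) * a ^ m) +
        ∑ j, (ofPolyXY Q - ofPolyXY P * ofX (ddx (y j))) * sumInvPowY fun m => y j ^ m) := by
  -- If `μ = 0`, the factorization forces `F = 0`.
  have hμ : μ ≠ 0 := by
    rintro rfl
    have h := hy.map_eq_prod
    rw [map_zero, C_0, zero_mul, Polynomial.map_eq_zero_iff ofPolyX_injective] at h
    exact hirr.ne_zero h
  simp only [sumInvPowX_roots hμ, sumInvPowY_eq_inv, ← div_eq_mul_inv]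
  rw [← hy.ofPolyXY_cofactor hirr.ne_zero hF.2, polyPart_ofPolyXY]
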